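/- Let $n\ge 1$ and $d\ge 2$, and let $C\subseteq(\mathbb C^2)^{\otimes n}$ be an $((n,2,d))$ qubit code: a $2$-dimensional subspace that detects all Pauli errors of weight less than $d$. Let $2\mathrm I\subset \mathrm{SU}(2)$ be the binary icosahedral group, i.e. any $\mathrm{SU}(2)$-conjugate of the group of order $120$ generated by $-iX$, $-iZ$, $\mathsf F=\tfrac{e^{-i\pi/4}}{\sqrt2}\begin{pmatrix}1&-i\\1&i\end{pmatrix}$ and $\mathsf\Phi=\tfrac12\begin{pmatrix}\varphi+i\varphi^{-1}&1\\-1&\varphi-i\varphi^{-1}\end{pmatrix}$, where $\varphi=(1+\sqrt5)/2$. Suppose that $C$ implements $2\mathrm I$ transversally: for some isometric encoding $E:\mathbb C^2\to(\mathbb C^2)^{\otimes n}$ with range $C$, every $g\in 2\mathrm I$ admits $U_1,\dots,U_n\in \mathrm U(2)$ with $(U_1\otimes\cdots\otimes U_n)E=Eg$. Then $C$ is non-additive: it is not equivalent via non-entangling gates (products of single-qubit unitaries and permutations of the qubits) to any stabilizer code, i.e. to any simultaneous $+1$ eigenspace of a subgroup of the $n$-qubit Pauli group. -/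

import Mathlib

/-- The vector space `(ℂ²)^{⊗n}` of `n` qubits, in computational-basis coordinates. The Hermitian
inner product of `v` and `w` is `star v ⬝ᵥ w`. -/
abbrev QubitSpace (n : ℕ) : Type := (Fin n → Fin 2) → ℂ

/-- The tensor product `A₁ ⊗ ⋯ ⊗ Aₙ` of one-qubit operators, as a matrix in the computational
basis. -/
def tensorOp {n : ℕ} (A : Fin n → Matrix (Fin 2) (Fin 2) ℂ) :
    Matrix (Fin n → Fin 2) (Fin n → Fin 2) ℂ :=
  Matrix.of fun x y => ∏ i, A i (x i) (y i)

/-- The operator permuting the qubits by `σ`: it sends the basis vector `|y⟩` to `|y ∘ σ⟩`. -/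
def permOp {n : ℕ} (σ : Equiv.Perm (Fin n)) :
    Matrix (Fin n → Fin 2) (Fin n → Fin 2) ℂ :=
  Matrix.of fun x y => if x = y ∘ σ then 1 else 0

/-- The four one-qubit operators `I, X, Y, Z`, indexed by `0, 1, 2, 3`. -/
def pauli : Fin 4 → Matrix (Fin 2) (Fin 2) ℂ :=
  ![1, !![0, 1; 1, 0], !![0, -Complex.I; Complex.I, 0], !![1, 0; 0, -1]]

/-- The `n`-qubit Pauli operator with tensor factors `pauli (p i)`. -/
def pauliString {n : ℕ} (p : Fin n → Fin 4) : Matrix (Fin n → Fin 2) (Fin n → Fin 2) ℂ :=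
  tensorOp fun i => pauli (p i)

/-- The weight of a Pauli operator: the number of qubits on which it is not the identity. -/
def pauliWeight {n : ℕ} (p : Fin n → Fin 4) : ℕ :=
  (Finset.univ.filter fun i => p i ≠ 0).card

/-- `C` is an `((n, K, d))` quantum code: it has dimension `K` and detects (Knill-Laflamme) every
Pauli error of weight less than `d`, i.e. its distance is at least `d`. -/
structure IsQuantumCode {n : ℕ} (C : Submodule ℂ (QubitSpace n)) (K d : ℕ) : Prop where
  finrank_eq : Module.finrank ℂ C = K
  detects : ∀ p : Fin n → Fin 4, pauliWeight p < d →
    ∃ c : ℂ, ∀ v ∈ C, ∀ w ∈ C,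
      star v ⬝ᵥ (Matrix.mulVec (pauliString p) w) = c * (star v ⬝ᵥ w)

/-- `C` is a stabilizer code: the simultaneous `+1` eigenspace of a subgroup `S` of the `n`-qubit
Pauli group `{iᵏ P₁ ⊗ ⋯ ⊗ Pₙ}`. -/
def IsStabilizerCode {n : ℕ} (C : Submodule ℂ (QubitSpace n)) : Prop :=
  ∃ S : Subgroup (Matrix.unitaryGroup (Fin n → Fin 2) ℂ),
    (∀ s ∈ S, ∃ (k : ℕ) (p : Fin n → Fin 4),
      (s : Matrix (Fin n → Fin 2) (Fin n → Fin 2) ℂ) = Complex.I ^ k • pauliString p) ∧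
    ∀ v : QubitSpace n, v ∈ C ↔
      ∀ s ∈ S, Matrix.mulVec (s : Matrix (Fin n → Fin 2) (Fin n → Fin 2) ℂ) v = v

/-- `W` is non-entangling: a permutation of the qubits followed by a product of one-qubit
unitaries. -/
def IsNonEntangling {n : ℕ} (W : Matrix (Fin n → Fin 2) (Fin n → Fin 2) ℂ) : Prop :=
  ∃ (U : Fin n → Matrix.unitaryGroup (Fin 2) ℂ) (σ : Equiv.Perm (Fin n)),
    W = tensorOp (fun i => (U i : Matrix (Fin 2) (Fin 2) ℂ)) * permOp σ

/-- Two `n`-qubit codes are equivalent via non-entangling gates. -/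
def CodeEquivalent {n : ℕ} (C C' : Submodule ℂ (QubitSpace n)) : Prop :=
  ∃ W, IsNonEntangling W ∧ C.map (Matrix.mulVecLin W) = C'

/-- A code is non-additive if it is not equivalent via non-entangling gates to any stabilizer
code. -/
def IsNonAdditive {n : ℕ} (C : Submodule ℂ (QubitSpace n)) : Prop :=
  ¬ ∃ C' : Submodule ℂ (QubitSpace n), IsStabilizerCode C' ∧ CodeEquivalent C C'

/-- `E` is an encoding of one logical qubit with codespace `C`: an isometry `ℂ² → (ℂ²)^{⊗n}` with
range `C` (its columns are the logical basis vectors `|0_L⟩, |1_L⟩`). -/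
def IsEncoding {n : ℕ} (C : Submodule ℂ (QubitSpace n))
    (E : Matrix (Fin n → Fin 2) (Fin 2) ℂ) : Prop :=
  E.conjTranspose * E = 1 ∧ LinearMap.range (Matrix.mulVecLin E) = C

/-- The code `C` implements the group `G` of logical gates transversally: for some choice of
orthonormal logical basis, every `g ∈ G` is implemented on the codespace by some
`U₁ ⊗ ⋯ ⊗ Uₙ` with all `Uᵢ ∈ U(2)`. (For `n ≥ 1`, a global phase can be absorbed in `U₁`.) -/
def ImplementsTransversally {n : ℕ} (C : Submodule ℂ (QubitSpace n))
    (G : Subgroup (Matrix.specialUnitaryGroup (Fin 2) ℂ)) : Prop :=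
  ∃ E : Matrix (Fin n → Fin 2) (Fin 2) ℂ, IsEncoding C E ∧
    ∀ g ∈ G, ∃ U : Fin n → Matrix.unitaryGroup (Fin 2) ℂ,
      tensorOp (fun i => (U i : Matrix (Fin 2) (Fin 2) ℂ)) * E =
        E * (g : Matrix (Fin 2) (Fin 2) ℂ)

/-- The determinant-one Pauli gate `-iX`. -/
noncomputable def gateX : Matrix.specialUnitaryGroup (Fin 2) ℂ :=
  ⟨!![0, -Complex.I; -Complex.I, 0], by
    rw [Matrix.mem_specialUnitaryGroup_iff, Matrix.mem_unitaryGroup_iff]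
    refine ⟨?_, by simp [Matrix.det_fin_two]⟩
    ext i j
    fin_cases i <;> fin_cases j <;> simp [Matrix.mul_apply, Matrix.star_apply]⟩

/-- The determinant-one Pauli gate `-iZ`. -/
noncomputable def gateZ : Matrix.specialUnitaryGroup (Fin 2) ℂ :=
  ⟨!![-Complex.I, 0; 0, Complex.I], by
    rw [Matrix.mem_specialUnitaryGroup_iff, Matrix.mem_unitaryGroup_iff]
    refine ⟨?_, by simp [Matrix.det_fin_two]⟩
    ext i j
    fin_cases i <;> fin_cases j <;> simp [Matrix.mul_apply, Matrix.star_apply]⟩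

/-- The determinant-one facet gate `(e^{-iπ/4} / √2) [[1, -i], [1, i]]`; the scalar factor is
`(1 - i) / 2`. -/
noncomputable def gateF : Matrix.specialUnitaryGroup (Fin 2) ℂ :=
  ⟨((1 - Complex.I) / 2) • !![1, -Complex.I; 1, Complex.I], by
    have hI : Complex.I ^ 2 = -1 := Complex.I_sq
    have h2 : (starRingEnd ℂ) 2 = 2 := Complex.conj_ofNat 2
    rw [Matrix.mem_specialUnitaryGroup_iff, Matrix.mem_unitaryGroup_iff]
    constructor
    · ext i j
      fin_cases i <;> fin_cases j <;> simp [Matrix.mul_apply, Matrix.star_apply, h2] <;> grind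
    · simp [Matrix.det_fin_two]
      grind⟩

theorem phi_mem_specialUnitaryGroup (a : ℝ) (ha : a ≠ 0) (h : a ^ 2 = a + 1) :
    (1 / 2 : ℂ) • !![(a : ℂ) + Complex.I * (a : ℂ)⁻¹, 1; -1, (a : ℂ) - Complex.I * (a : ℂ)⁻¹] ∈
      Matrix.specialUnitaryGroup (Fin 2) ℂ := by
  have hI : Complex.I ^ 2 = -1 := Complex.I_sq
  have hc : (starRingEnd ℂ) 2 = 2 := Complex.conj_ofNat 2
  have h0 : (a : ℂ) ≠ 0 := by exact_mod_cast ha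
  have h1 : (a : ℂ) ^ 2 = a + 1 := by exact_mod_cast h
  have h2 : (a : ℂ)⁻¹ = a - 1 := by grind
  rw [h2, Matrix.mem_specialUnitaryGroup_iff, Matrix.mem_unitaryGroup_iff]
  constructor
  · ext i j
    fin_cases i <;> fin_cases j <;> simp [Matrix.mul_apply, Matrix.star_apply, hc] <;> grind
  · simp [Matrix.det_fin_two]
    grind

/-- The gate `Φ = (1/2) [[φ + iφ⁻¹, 1], [-1, φ - iφ⁻¹]]`, with `φ = (1 + √5)/2`. -/
noncomputable def gatePhi : Matrix.specialUnitaryGroup (Fin 2) ℂ :=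
  ⟨(1 / 2 : ℂ) •
      !![(Real.goldenRatio : ℂ) + Complex.I * (Real.goldenRatio : ℂ)⁻¹, 1;
        -1, (Real.goldenRatio : ℂ) - Complex.I * (Real.goldenRatio : ℂ)⁻¹],
    phi_mem_specialUnitaryGroup Real.goldenRatio Real.goldenRatio_ne_zero Real.goldenRatio_sq⟩

/-- The standard realization `⟨-iX, -iZ, F, Φ⟩` of the binary icosahedral group in `SU(2)`. -/
noncomputable def binaryIcosahedral : Subgroup (Matrix.specialUnitaryGroup (Fin 2) ℂ) :=
  Subgroup.closure {gateX, gateZ, gateF, gatePhi}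

/-- `G` is a realization of the binary icosahedral group `2I` in `SU(2)`: a conjugate of the
standard one. -/
def IsBinaryIcosahedral (G : Subgroup (Matrix.specialUnitaryGroup (Fin 2) ℂ)) : Prop :=
  ∃ h : Matrix.specialUnitaryGroup (Fin 2) ℂ,
    G = binaryIcosahedral.map (MulAut.conj h).toMonoidHom

/-! ### Tensor products of one-qubit operators and qubit permutations -/

section TensorOp

variable {n : ℕ}

/-! Non-entangling gates preserve both the distance condition and transversality, so it suffices to
study a stabilizer code. There every Pauli string either preserves the code or maps it to an
orthogonal space (`IsStabilizerCode.logicalPauli_dichotomy`); in the first case its compression is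
an involution.

Among the strings with non-scalar compression take `p` of least weight; the weight is at least two
because `2 ≤ d`. Conjugation by a transversal gate expands `p` in strings of the same support. Two
non-commuting transversal gates of nonzero trace therefore force some `q` on that support to
anticommute logically with `p`. If two strings on the support agree at one of its sites, their
product is lighter, hence logically scalar, so their compressions are proportional or one of them
vanishes. Consequently `p`, `q` and `pq` differ at every site of the support and are the only
strings there with nonzero compression (`exists_triple`).

In the basis of these three logical Paulis a transversal `g` acts by a rotation whose entries are
products, over the sites, of entries of one-qubit rotations. Its rows are unit vectors, and with at
least two sites in the support this is possible only if each row is a signed basis vector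
(`exists_int_of_sum_sq_prod_eq_one`). So the trace `|tr g|² - 1` of the rotation is an integer
(`sum_trace_conj_mul`, `exists_int_trace`). For `Φ` it equals `φ² - 1 = φ`, which is irrational. -/

theorem tensorOp_mul (A B : Fin n → Matrix (Fin 2) (Fin 2) ℂ) :
    tensorOp A * tensorOp B = tensorOp fun i => A i * B i := by
  ext x y
  simp only [tensorOp, Matrix.mul_apply, Matrix.of_apply, Finset.prod_univ_sum,
    Fintype.piFinset_univ, Finset.prod_mul_distrib]

theorem tensorOp_one : tensorOp (fun _ : Fin n => (1 : Matrix (Fin 2) (Fin 2) ℂ)) = 1 := by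
  ext x y
  simp only [tensorOp, Matrix.of_apply, Matrix.one_apply]
  by_cases h : x = y
  · simp [h]
  · obtain ⟨i, hi⟩ := Function.ne_iff.mp h
    rw [if_neg h]
    exact Finset.prod_eq_zero (Finset.mem_univ i) (if_neg hi)

theorem tensorOp_conjTranspose (A : Fin n → Matrix (Fin 2) (Fin 2) ℂ) :
    (tensorOp A).conjTranspose = tensorOp fun i => (A i).conjTranspose := by
  ext x y
  simp [tensorOp, Matrix.conjTranspose_apply]

theorem tensorOp_smul (c : Fin n → ℂ) (A : Fin n → Matrix (Fin 2) (Fin 2) ℂ) :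
    tensorOp (fun i => c i • A i) = (∏ i, c i) • tensorOp A := by
  ext x y
  simp [tensorOp, Finset.prod_mul_distrib]

/-- Expansion of a product operator in Pauli operators. -/
theorem tensorOp_sum_pauli (x : Fin n → Fin 4 → ℂ) :
    tensorOp (fun i => ∑ r, x i r • pauli r) =
      ∑ r : Fin n → Fin 4, (∏ i, x i (r i)) • pauliString r := by
  ext a b
  simp only [pauliString, tensorOp, Matrix.of_apply, Matrix.sum_apply, Matrix.smul_apply,
    Finset.prod_univ_sum, Fintype.piFinset_univ, Finset.prod_mul_distrib, smul_eq_mul]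

theorem permOp_mul_tensorOp (σ : Equiv.Perm (Fin n)) (A : Fin n → Matrix (Fin 2) (Fin 2) ℂ) :
    permOp σ * tensorOp A = tensorOp (fun i => A (σ i)) * permOp σ := by
  ext x y
  have h : ∀ z : Fin n → Fin 2, x = z ∘ σ ↔ z = x ∘ σ.symm := fun z =>
    ⟨fun h => by simp [h, Function.comp_assoc], fun h => by simp [h, Function.comp_assoc]⟩
  simp only [permOp, tensorOp, Matrix.mul_apply, Matrix.of_apply, h, ite_mul, one_mul, zero_mul,
    mul_ite, mul_one, mul_zero, Finset.sum_ite_eq', Finset.mem_univ, if_true]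
  rw [← Equiv.prod_comp σ]
  simp

theorem permOp_conjTranspose_mul_self (σ : Equiv.Perm (Fin n)) :
    (permOp σ).conjTranspose * permOp σ = 1 := by
  ext x y
  simp only [permOp, Matrix.mul_apply, Matrix.conjTranspose_apply, Matrix.of_apply,
    Matrix.one_apply, mul_ite, mul_one, mul_zero, Finset.sum_ite_eq', Finset.mem_univ, if_true]
  have h : y ∘ σ = x ∘ σ ↔ x = y :=
    ⟨fun h => (σ.surjective.injective_comp_right h).symm, fun h => by rw [h]⟩
  simp [h, apply_ite]

theorem tensorOp_unitary_conjTranspose_mul_self (U : Fin n → Matrix.unitaryGroup (Fin 2) ℂ) :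
    (tensorOp fun i => (U i : Matrix (Fin 2) (Fin 2) ℂ)).conjTranspose *
      (tensorOp fun i => (U i : Matrix (Fin 2) (Fin 2) ℂ)) = 1 := by
  rw [tensorOp_conjTranspose, tensorOp_mul, ← tensorOp_one]
  congr 1
  ext1 i
  exact (U i).2.1

end TensorOp

/-! ### One-qubit Pauli algebra -/

section Pauli

/-- The product of two one-qubit Pauli operators up to phase, on labels. -/
def pauliMul (a b : Fin 4) : Fin 4 :=
  ![![0, 1, 2, 3], ![1, 0, 3, 2], ![2, 3, 0, 1], ![3, 2, 1, 0]] a b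

theorem pauli_mul (a b : Fin 4) :
    ∃ c : ℂ, c ≠ 0 ∧ pauli a * pauli b = c • pauli (pauliMul a b) := by
  refine ⟨(![![1, 1, 1, 1], ![1, 1, Complex.I, -Complex.I], ![1, -Complex.I, 1, Complex.I],
    ![1, Complex.I, -Complex.I, 1]] : Fin 4 → Fin 4 → ℂ) a b, ?_, ?_⟩
  · fin_cases a <;> fin_cases b <;> simp
  · fin_cases a <;> fin_cases b <;> ext i j <;> fin_cases i <;> fin_cases j <;>
      simp [pauli, pauliMul]

theorem pauli_mul_self (a : Fin 4) : pauli a * pauli a = 1 := by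
  fin_cases a <;> ext i j <;> fin_cases i <;> fin_cases j <;> simp [pauli]

theorem pauli_conjTranspose (a : Fin 4) : (pauli a).conjTranspose = pauli a := by
  fin_cases a <;> ext i j <;> fin_cases i <;> fin_cases j <;>
    simp [pauli, Matrix.conjTranspose_apply]

theorem pauli_trace {a : Fin 4} (ha : a ≠ 0) : (pauli a).trace = 0 := by
  fin_cases a <;> simp_all [pauli, Matrix.trace_fin_two]

theorem pauli_comm (a b : Fin 4) :
    ∃ ε : ℤˣ, pauli a * pauli b = ((ε : ℤ) : ℂ) • (pauli b * pauli a) := by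
  by_cases h : a = 0 ∨ b = 0 ∨ a = b
  · exact ⟨1, by rcases h with rfl | rfl | rfl <;> simp [pauli]⟩
  · refine ⟨-1, ?_⟩
    fin_cases a <;> fin_cases b <;> simp at h <;> ext i j <;> fin_cases i <;> fin_cases j <;>
      simp [pauli]

theorem exists_eq_sum_pauli (A : Matrix (Fin 2) (Fin 2) ℂ) :
    ∃ x : Fin 4 → ℂ, A = ∑ r, x r • pauli r := by
  have hI : Complex.I * Complex.I = -1 := Complex.I_mul_I
  -- The coefficient at `r` is `tr (A * pauli r) / 2`.
  refine ⟨![(A 0 0 + A 1 1) / 2, (A 0 1 + A 1 0) / 2, Complex.I * (A 0 1 - A 1 0) / 2,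
    (A 0 0 - A 1 1) / 2], ?_⟩
  ext i j
  fin_cases i <;> fin_cases j <;> simp [Fin.sum_univ_four, pauli] <;> grind

/-- The adjoint action of a one-qubit unitary on Pauli operators is given by a real orthogonal
matrix fixing the identity. -/
theorem exists_unitary_conj_pauli (U : Matrix.unitaryGroup (Fin 2) ℂ) (p : Fin 4) :
    ∃ x : Fin 4 → ℝ, ∑ r, x r ^ 2 = 1 ∧ (∀ r, x r ≠ 0 → (r = 0 ↔ p = 0)) ∧
      (U : Matrix (Fin 2) (Fin 2) ℂ).conjTranspose * pauli p * U =
        ∑ r, (x r : ℂ) • pauli r := by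
  have hUl : (U : Matrix (Fin 2) (Fin 2) ℂ).conjTranspose * U = 1 := U.2.1
  have hUr : (U : Matrix (Fin 2) (Fin 2) ℂ) * (U : Matrix (Fin 2) (Fin 2) ℂ).conjTranspose = 1 :=
    U.2.2
  by_cases hp : p = 0
  · subst hp
    refine ⟨Pi.single 0 1, ?_, ?_, ?_⟩
    · simp [Fin.sum_univ_four]
    · intro r hr
      by_contra h
      exact hr (Pi.single_eq_of_ne (by simpa using h) _)
    · simp [pauli, hUl]
  · set A := (U : Matrix (Fin 2) (Fin 2) ℂ).conjTranspose * pauli p * U with hA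
    have hH : A.conjTranspose = A := by
      rw [hA]
      simp [Matrix.conjTranspose_mul, pauli_conjTranspose, Matrix.mul_assoc]
    have hS : A * A = 1 := by
      calc A * A = (U : Matrix (Fin 2) (Fin 2) ℂ).conjTranspose * pauli p *
            ((U : Matrix (Fin 2) (Fin 2) ℂ) * (U : Matrix (Fin 2) (Fin 2) ℂ).conjTranspose) *
            pauli p * U := by simp only [hA, Matrix.mul_assoc]
        _ = (U : Matrix (Fin 2) (Fin 2) ℂ).conjTranspose * (pauli p * pauli p) * U := by
            rw [hUr]; simp only [Matrix.mul_assoc, Matrix.one_mul]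
        _ = 1 := by rw [pauli_mul_self, Matrix.mul_one, hUl]
    have hT : A.trace = 0 := by
      rw [hA, Matrix.mul_assoc, Matrix.trace_mul_comm, Matrix.mul_assoc, hUr, Matrix.mul_one,
        pauli_trace hp]
    have h00 := congrFun (congrFun hH 0) 0
    have h10 := congrFun (congrFun hH 1) 0
    have hs := congrFun (congrFun hS 0) 0
    rw [Matrix.trace_fin_two] at hT
    simp only [Matrix.conjTranspose_apply, Matrix.mul_apply, Fin.sum_univ_two] at h00 h10 hs
    have him : (A 0 0).im = 0 := Complex.conj_eq_iff_im.mp h00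
    -- Bloch coordinates of the traceless Hermitian `A`; that they form a unit vector is the `(0,
    -- 0)` entry of `A * A = 1`.
    refine ⟨![0, (A 0 1).re, -(A 0 1).im, (A 0 0).re], ?_, ?_, ?_⟩
    · have := congrArg Complex.re hs
      rw [← h10] at this
      simp [him] at this
      simp [Fin.sum_univ_four]
      linarith
    · intro r hr
      fin_cases r <;> simp_all
    · have h11 : A 1 1 = - A 0 0 := by linear_combination hT
      ext i j
      fin_cases i <;> fin_cases j <;>
        simp [Fin.sum_univ_four, pauli, h11, ← h10, Complex.ext_iff, him]

end Pauli

/-! ### Pauli strings: products, spanning, conjugation by local unitaries -/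

section PauliString

variable {n : ℕ}

theorem pauliString_mul (p q : Fin n → Fin 4) :
    ∃ c : ℂ, c ≠ 0 ∧ pauliString p * pauliString q =
      c • pauliString fun i => pauliMul (p i) (q i) := by
  choose c hc h using pauli_mul
  refine ⟨∏ i, c (p i) (q i), Finset.prod_ne_zero_iff.mpr fun i _ => hc _ _, ?_⟩
  simp only [pauliString, tensorOp_mul, h, tensorOp_smul]

theorem pauliString_mul_self (p : Fin n → Fin 4) : pauliString p * pauliString p = 1 := by
  simp only [pauliString, tensorOp_mul, pauli_mul_self, tensorOp_one]

theorem pauliString_comm (p q : Fin n → Fin 4) :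
    pauliString p * pauliString q = pauliString q * pauliString p ∨
      pauliString p * pauliString q = -(pauliString q * pauliString p) := by
  choose ε h using pauli_comm
  have : pauliString p * pauliString q =
      (((∏ i, ε (p i) (q i) : ℤˣ) : ℤ) : ℂ) • (pauliString q * pauliString p) := by
    simp only [pauliString, tensorOp_mul]
    rw [funext fun i => h (p i) (q i), tensorOp_smul]
    simp
  rcases Int.units_eq_one_or (∏ i, ε (p i) (q i)) with h1 | h1 <;> rw [h1] at this
  · left; simpa using this
  · right; simpa using this

/-- Matrix units are tensor products of one-qubit matrix units, and each factor expands in Paulis.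
-/
theorem mem_span_pauliString (A : Matrix (Fin n → Fin 2) (Fin n → Fin 2) ℂ) :
    A ∈ Submodule.span ℂ (Set.range (pauliString (n := n))) := by
  have hs : ∀ x y : Fin n → Fin 2, Matrix.single x y (1 : ℂ) =
      tensorOp fun i => Matrix.single (x i) (y i) 1 := by
    intro x y
    ext a b
    simp only [tensorOp, Matrix.of_apply, Matrix.single_apply]
    rw [Finset.prod_ite_zero]
    simp [funext_iff, forall_and]
  rw [Matrix.matrix_eq_sum_single A]
  refine Submodule.sum_mem _ fun x _ => Submodule.sum_mem _ fun y _ => ?_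
  have : Matrix.single x y (A x y) = A x y • Matrix.single x y (1 : ℂ) := by simp
  rw [this, hs]
  choose c hc using exists_eq_sum_pauli
  rw [funext fun i => hc (Matrix.single (x i) (y i) 1), tensorOp_sum_pauli]
  exact Submodule.smul_mem _ _ <| Submodule.sum_mem _ fun r _ =>
    Submodule.smul_mem _ _ <| Submodule.subset_span ⟨r, rfl⟩

theorem exists_unitary_conj_pauliString (U : Fin n → Matrix.unitaryGroup (Fin 2) ℂ)
    (p : Fin n → Fin 4) :
    ∃ x : Fin n → Fin 4 → ℝ, (∀ i, ∑ r, x i r ^ 2 = 1) ∧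
      (∀ r : Fin n → Fin 4, ∏ i, x i (r i) ≠ 0 → ∀ i, r i = 0 ↔ p i = 0) ∧
      (tensorOp fun i => (U i : Matrix (Fin 2) (Fin 2) ℂ)).conjTranspose * pauliString p *
        (tensorOp fun i => (U i : Matrix (Fin 2) (Fin 2) ℂ)) =
        ∑ r : Fin n → Fin 4, ((∏ i, x i (r i) : ℝ) : ℂ) • pauliString r := by
  choose x h1 h2 h3 using fun i => exists_unitary_conj_pauli (U i) (p i)
  refine ⟨x, h1, fun r hr i => h2 i _ (Finset.prod_ne_zero_iff.mp hr i (Finset.mem_univ i)), ?_⟩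
  rw [pauliString, tensorOp_conjTranspose, tensorOp_mul, tensorOp_mul]
  simp only [h3]
  rw [tensorOp_sum_pauli]
  push_cast
  rfl

theorem permOp_conj_pauliString (σ : Equiv.Perm (Fin n)) (p : Fin n → Fin 4) :
    (permOp σ).conjTranspose * pauliString p * permOp σ = pauliString (p ∘ σ.symm) := by
  have : pauliString p * permOp σ = permOp σ * pauliString (p ∘ σ.symm) := by
    simp [pauliString, permOp_mul_tensorOp]
  rw [Matrix.mul_assoc, this, ← Matrix.mul_assoc, permOp_conjTranspose_mul_self, Matrix.one_mul]

theorem pauliWeight_comp_perm (σ : Equiv.Perm (Fin n)) (p : Fin n → Fin 4) :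
    pauliWeight (p ∘ σ) = pauliWeight p := by
  unfold pauliWeight
  refine Finset.card_equiv σ ?_
  simp

end PauliString

/-! ### Linear algebra of 2 × 2 matrices and the integrality of product rows -/

section TwoByTwo

variable {M N g : Matrix (Fin 2) (Fin 2) ℂ}

theorem matrix_eq_zero_of_eq_neg {ι κ : Type*} {A : Matrix ι κ ℂ} (h : A = -A) : A = 0 := by
  ext i j
  exact self_eq_neg.mp (congrFun (congrFun h i) j)

/-- A `2 × 2` matrix commuting with two matrices that do not commute with each other is scalar. -/
theorem eq_smul_one_of_commute_of_not_commute {A B X : Matrix (Fin 2) (Fin 2) ℂ}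
    (hA : A * X = X * A) (hB : B * X = X * B) (hAB : A * B ≠ B * A) :
    ∃ c : ℂ, X = c • 1 := by
  simp only [← Matrix.ext_iff, Fin.forall_fin_two, Matrix.mul_apply, Fin.sum_univ_two, Ne] at *
  refine ⟨X 0 0, ?_⟩
  simp only [Matrix.smul_apply, Matrix.one_apply_eq, smul_eq_mul, mul_one, true_and,
    Matrix.one_apply_ne (zero_ne_one : (0 : Fin 2) ≠ 1),
    Matrix.one_apply_ne (one_ne_zero : (1 : Fin 2) ≠ 0), mul_zero]
  grind

/-- Traceless 2 × 2 matrices have a scalar anticommutator. If they also commute, `M * N` is itself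
scalar, and multiplying by the involution `M` isolates `N`. -/
theorem eq_smul_of_commute_of_trace_eq_zero (hM : M.trace = 0) (hN : N.trace = 0)
    (hMM : M * M = 1) (h : M * N = N * M) : ∃ c : ℂ, N = c • M := by
  have h1 : M * N + N * M = (M * N).trace • (1 : Matrix (Fin 2) (Fin 2) ℂ) := by
    rw [Matrix.trace_fin_two] at hM hN
    ext i j
    fin_cases i <;> fin_cases j <;> simp [Matrix.mul_apply, Matrix.trace_fin_two] <;> grind
  refine ⟨(M * N).trace / 2, ?_⟩
  have h2 : M * N = ((M * N).trace / 2) • (1 : Matrix (Fin 2) (Fin 2) ℂ) := by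
    rw [← h, ← two_smul ℂ] at h1
    rw [div_eq_inv_mul, mul_smul, ← h1, smul_smul]
    norm_num
  calc N = M * (M * N) := by rw [← Matrix.mul_assoc, hMM, Matrix.one_mul]
    _ = _ := by rw [h2]; simp

/-- If a traceless involution commutes with its conjugate by a unitary of nonzero trace, then it
commutes with the unitary. -/
theorem commute_of_commute_conj (hM : M.trace = 0) (hMM : M * M = 1)
    (hg : g * g.conjTranspose = 1) (hgt : g.trace ≠ 0)
    (h : M * (g.conjTranspose * M * g) = g.conjTranspose * M * g * M) : g * M = M * g := by
  have ht : (g.conjTranspose * M * g).trace = 0 := by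
    rw [Matrix.mul_assoc, Matrix.trace_mul_comm, Matrix.mul_assoc, hg, Matrix.mul_one, hM]
  obtain ⟨c, hc⟩ := eq_smul_of_commute_of_trace_eq_zero hM ht hMM h
  have h1 : M * g = c • (g * M) := by
    rw [← Matrix.mul_smul, ← hc, ← Matrix.mul_assoc, ← Matrix.mul_assoc, hg, Matrix.one_mul]
  have h2 : g.trace = c * g.trace := by
    have : (M * g * M).trace = c * (g * M * M).trace := by
      rw [h1, Matrix.smul_mul, Matrix.trace_smul, smul_eq_mul]
    rw [Matrix.trace_mul_comm, ← Matrix.mul_assoc, hMM, Matrix.one_mul, Matrix.mul_assoc, hMM,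
      Matrix.mul_one] at this
    exact this
  have h3 : c = 1 := mul_right_cancel₀ hgt (by rw [← h2, one_mul])
  rw [h1, h3, one_smul]

/-- `∑ₐ ½ tr(g* Mₐ g Mₐ) = |tr g|² - 1` for three anticommuting involutions `Mₐ`. -/
theorem sum_trace_conj_mul (M : Fin 3 → Matrix (Fin 2) (Fin 2) ℂ) (hMM : ∀ a, M a * M a = 1)
    (hac : ∀ a b, a ≠ b → M a * M b = -(M b * M a))
    (h2 : ∃ c : ℂ, M 2 = c • (M 0 * M 1))
    (hg : g.conjTranspose * g = 1) :
    ∑ a, (g.conjTranspose * M a * g * M a).trace = 2 * (g.conjTranspose.trace * g.trace) - 2 := by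
  -- The Pauli twirl of `g`: it commutes with `M 0` and `M 1`, so it is a scalar, and its trace
  -- identifies it as `2 * g.trace`.
  set T := g + ∑ a, M a * g * M a with hT
  obtain ⟨c, h2⟩ := h2
  have r0 : ∀ X, M 0 * (M 0 * X) = X := fun X => by rw [← Matrix.mul_assoc, hMM, Matrix.one_mul]
  have r1 : ∀ X, M 1 * (M 1 * X) = X := fun X => by rw [← Matrix.mul_assoc, hMM, Matrix.one_mul]
  have s1 : M 1 * M 0 = -(M 0 * M 1) := hac 1 0 (by decide)
  have s1' : ∀ X, M 1 * (M 0 * X) = -(M 0 * (M 1 * X)) := fun X => by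
    rw [← Matrix.mul_assoc, s1, Matrix.neg_mul, Matrix.mul_assoc]
  have hcc : c * c = -1 := by
    have := hMM 2
    rw [h2] at this
    simp [Matrix.mul_assoc, s1', hMM, smul_smul] at this
    have := congrFun (congrFun this 0) 0
    simp at this
    linear_combination -this
  have e2 : M 2 * g * M 2 = - (M 0 * (M 1 * (g * (M 0 * M 1)))) := by
    rw [h2]
    simp [Matrix.mul_assoc, smul_smul, hcc]
  have hTe : T = g + (M 0 * (g * M 0) + M 1 * (g * M 1) - M 0 * (M 1 * (g * (M 0 * M 1)))) := by
    rw [hT, Fin.sum_univ_three, e2]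
    simp only [Matrix.mul_assoc, sub_eq_add_neg]
  have hT0 : M 0 * T = T * M 0 := by
    rw [hTe]
    simp only [Matrix.mul_add, Matrix.add_mul, Matrix.mul_sub, Matrix.sub_mul, Matrix.mul_assoc,
      r0, hMM, s1, Matrix.mul_neg, Matrix.mul_one]
    abel
  have hT1 : M 1 * T = T * M 1 := by
    rw [hTe]
    simp only [Matrix.mul_add, Matrix.add_mul, Matrix.mul_sub, Matrix.sub_mul, Matrix.mul_assoc,
      r1, hMM, s1', Matrix.mul_one]
    abel
  have hne : M 0 * M 1 ≠ M 1 * M 0 := by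
    intro h
    rw [s1] at h
    have h0 : M 0 * M 1 = 0 := matrix_eq_zero_of_eq_neg h
    have := r0 (M 1 * 1)
    rw [Matrix.mul_one, h0, Matrix.mul_zero] at this
    have h1 := hMM 1
    rw [← this, Matrix.mul_zero] at h1
    exact zero_ne_one h1
  obtain ⟨z, hz⟩ := eq_smul_one_of_commute_of_not_commute hT0 hT1 hne
  have htr : T.trace = 4 * g.trace := by
    rw [hT, Matrix.trace_add, Matrix.trace_sum]
    have : ∀ a, (M a * g * M a).trace = g.trace := fun a => by
      rw [Matrix.trace_mul_comm, ← Matrix.mul_assoc, hMM, Matrix.one_mul]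
    simp only [this, Finset.sum_const, Finset.card_univ, Fintype.card_fin, nsmul_eq_mul]
    push_cast
    ring
  have hzt : z = 2 * g.trace := by
    rw [hz, Matrix.trace_smul, Matrix.trace_one] at htr
    simp at htr
    linear_combination htr / 2
  have hs : ∑ a, (g.conjTranspose * M a * g * M a).trace =
      (g.conjTranspose * T).trace - 2 := by
    rw [hT, Matrix.mul_add, hg, Matrix.trace_add, Matrix.mul_sum, Matrix.trace_sum]
    simp [Matrix.mul_assoc]
  rw [hs, hz, hzt]
  simp
  ring

/-- If a product of at least two unit vectors, restricted to three pairwise distinct labels at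
each site, still has unit norm, then its entries are integers. -/
theorem exists_int_of_sum_sq_prod_eq_one {ι : Type*} [Fintype ι] [DecidableEq ι]
    (x : ι → Fin 4 → ℝ) (hx : ∀ i, ∑ r, x i r ^ 2 = 1) (u : Fin 3 → ι → Fin 4) {i j : ι}
    (hij : i ≠ j) (hi : Function.Injective fun b => u b i)
    (hj : Function.Injective fun b => u b j)
    (h : ∑ b, (∏ k, x k (u b k)) ^ 2 = 1) (b : Fin 3) :
    ∃ z : ℤ, ∏ k, x k (u b k) = z := by
  have hle1 : ∀ k r, x k r ^ 2 ≤ 1 := fun k r => by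
    rw [← hx k]
    exact Finset.single_le_sum (f := fun r => x k r ^ 2) (fun _ _ => sq_nonneg _)
      (Finset.mem_univ r)
  have hsub : ∀ k, (Function.Injective fun b => u b k) → ∑ b, x k (u b k) ^ 2 ≤ 1 :=
    fun k hk => by
      rw [← hx k, ← Finset.sum_image (g := fun b => u b k) (f := fun r => x k r ^ 2)
        (fun _ _ _ _ h => hk h)]
      exact Finset.sum_le_sum_of_subset_of_nonneg (Finset.subset_univ _)
        fun _ _ _ => sq_nonneg _
  have hprod : ∀ b, (∏ k, x k (u b k)) ^ 2 ≤ x i (u b i) ^ 2 * x j (u b j) ^ 2 := fun b => by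
    rw [← Finset.prod_pow, ← Finset.prod_pair (f := fun k => x k (u b k) ^ 2) hij]
    rw [← Finset.prod_sdiff (Finset.subset_univ {i, j})]
    refine mul_le_of_le_one_left (Finset.prod_nonneg fun _ _ => sq_nonneg _) ?_
    exact Finset.prod_le_one (fun _ _ => sq_nonneg _) fun k _ => hle1 _ _
  have hle : ∀ b ∈ Finset.univ, (∏ k, x k (u b k)) ^ 2 ≤ x i (u b i) ^ 2 := fun b _ =>
    (hprod b).trans (mul_le_of_le_one_right (sq_nonneg _) (hle1 _ _))
  -- The total 1 is squeezed between the two sums, so the termwise bounds `hle` are equalities. A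
  -- nonzero entry at `b` then forces the factor at `j` to have square 1, which leaves no mass at
  -- `j` for the other labels.
  have heq : ∑ b, (∏ k, x k (u b k)) ^ 2 = ∑ b, x i (u b i) ^ 2 :=
    le_antisymm (Finset.sum_le_sum hle) (by rw [h]; exact hsub i hi)
  have heq' := (Finset.sum_eq_sum_iff_of_le hle).mp heq
  by_cases h0 : ∏ k, x k (u b k) = 0
  · exact ⟨0, by simpa using h0⟩
  have hpos : 0 < x i (u b i) ^ 2 := by
    rw [← heq' b (Finset.mem_univ b)]
    positivity
  have hxj : 1 ≤ x j (u b j) ^ 2 := by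
    have := hprod b
    rw [heq' b (Finset.mem_univ b)] at this
    exact le_of_mul_le_mul_left (by rwa [mul_one]) hpos
  have hz : ∀ b', b' ≠ b → (∏ k, x k (u b' k)) = 0 := fun b' hb => by
    have h1 : x j (u b j) ^ 2 + x j (u b' j) ^ 2 ≤ 1 := by
      refine le_trans ?_ (hsub j hj)
      rw [← Finset.sum_pair (f := fun b => x j (u b j) ^ 2) hb.symm]
      exact Finset.sum_le_sum_of_subset_of_nonneg (Finset.subset_univ _)
        fun _ _ _ => sq_nonneg _
    refine Finset.prod_eq_zero (Finset.mem_univ j) (pow_eq_zero_iff two_ne_zero |>.mp ?_)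
    nlinarith [sq_nonneg (x j (u b' j))]
  rw [Finset.sum_eq_single b (fun b' _ hb => by rw [hz b' hb]; simp) (by simp)] at h
  rcases sq_eq_sq_iff_eq_or_eq_neg.mp (h.trans (one_pow 2).symm) with h | h
  · exact ⟨1, by simpa using h⟩
  · exact ⟨-1, by simpa using h⟩

end TwoByTwo

/-! ### Traces and non-commutation of the gates `F` and `Φ` -/

section Icosahedral

theorem gateF_trace : (gateF : Matrix (Fin 2) (Fin 2) ℂ).trace = 1 := by
  have hI : Complex.I ^ 2 = -1 := Complex.I_sq
  simp [gateF, Matrix.trace_fin_two]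
  grind

theorem gatePhi_trace :
    (gatePhi : Matrix (Fin 2) (Fin 2) ℂ).trace = (Real.goldenRatio : ℂ) := by
  simp [gatePhi, Matrix.trace_fin_two]
  ring

theorem gateF_gatePhi_not_commute :
    (gateF : Matrix (Fin 2) (Fin 2) ℂ) * (gatePhi : Matrix (Fin 2) (Fin 2) ℂ) ≠
      (gatePhi : Matrix (Fin 2) (Fin 2) ℂ) * (gateF : Matrix (Fin 2) (Fin 2) ℂ) := by
  intro h
  have hI : Complex.I ^ 2 = -1 := Complex.I_sq
  have := congrFun (congrFun h 0) 0
  simp [gateF, gatePhi, Matrix.mul_apply] at this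
  -- The `(0, 0)` entries of the two products differ by `I / 2`.
  exact Complex.I_ne_zero (by linear_combination 2 * this + hI / 2)

end Icosahedral

/-! ### Logical Pauli operators and the rigidity of transversal gates -/

section LogicalPauli

variable {n : ℕ} {E : Matrix (Fin n → Fin 2) (Fin 2) ℂ}

/-- The compression of a Pauli operator to the codespace, as a logical operator. -/
def logicalPauli (E : Matrix (Fin n → Fin 2) (Fin 2) ℂ) (p : Fin n → Fin 4) :
    Matrix (Fin 2) (Fin 2) ℂ :=
  E.conjTranspose * pauliString p * E

theorem logicalPauli_mul_self (hE : E.conjTranspose * E = 1) {p : Fin n → Fin 4}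
    (hp : pauliString p * E = E * logicalPauli E p) :
    logicalPauli E p * logicalPauli E p = 1 := by
  calc logicalPauli E p * logicalPauli E p
      = E.conjTranspose * pauliString p * (E * logicalPauli E p) := by
        rw [← Matrix.mul_assoc]; rfl
    _ = E.conjTranspose * (pauliString p * pauliString p) * E := by
        rw [← hp]; simp only [Matrix.mul_assoc]
    _ = 1 := by rw [pauliString_mul_self, Matrix.mul_one, hE]

/-- Only the right factor has to preserve the code: the projection between the two factors then acts
trivially. -/
theorem logicalPauli_mul {p q : Fin n → Fin 4} (hq : pauliString q * E = E * logicalPauli E q) :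
    logicalPauli E p * logicalPauli E q =
      E.conjTranspose * (pauliString p * pauliString q) * E := by
  calc logicalPauli E p * logicalPauli E q
      = E.conjTranspose * pauliString p * (E * logicalPauli E q) := by
        rw [← Matrix.mul_assoc]; rfl
    _ = _ := by rw [← hq]; simp only [Matrix.mul_assoc]

theorem exists_logicalPauli_mul {p q : Fin n → Fin 4}
    (hq : pauliString q * E = E * logicalPauli E q) :
    ∃ c : ℂ, c ≠ 0 ∧ logicalPauli E p * logicalPauli E q =
      c • logicalPauli E fun i => pauliMul (p i) (q i) := by
  obtain ⟨c, hc, h⟩ := pauliString_mul p q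
  exact ⟨c, hc, by rw [logicalPauli_mul hq, h]; simp [logicalPauli]⟩

theorem logicalPauli_comm {p q : Fin n → Fin 4} (hp : pauliString p * E = E * logicalPauli E p)
    (hq : pauliString q * E = E * logicalPauli E q) :
    logicalPauli E p * logicalPauli E q = logicalPauli E q * logicalPauli E p ∨
      logicalPauli E p * logicalPauli E q = -(logicalPauli E q * logicalPauli E p) := by
  rw [logicalPauli_mul hq, logicalPauli_mul hp]
  rcases pauliString_comm p q with h | h <;> rw [h]
  · exact Or.inl rfl
  · right; simp

/-- Pauli strings span all operators, and every logical `B` is the compression of `E * B *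
E.conjTranspose`; so `X` is central. -/
theorem eq_smul_one_of_commute_logicalPauli (hE : E.conjTranspose * E = 1)
    {X : Matrix (Fin 2) (Fin 2) ℂ}
    (hX : ∀ p, logicalPauli E p * X = X * logicalPauli E p) : ∃ c : ℂ, X = c • 1 := by
  have h1 : ∀ A : Matrix (Fin n → Fin 2) (Fin n → Fin 2) ℂ,
      E.conjTranspose * A * E * X = X * (E.conjTranspose * A * E) := by
    intro A
    induction mem_span_pauliString A using Submodule.span_induction with
    | mem A hA =>
      obtain ⟨p, rfl⟩ := hA
      exact hX p
    | zero => simp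
    | add A B _ _ hA hB => simp only [Matrix.mul_add, Matrix.add_mul, hA, hB]
    | smul c A _ hA => simp only [Matrix.mul_smul, Matrix.smul_mul, hA]
  have h2 : ∀ B : Matrix (Fin 2) (Fin 2) ℂ, B * X = X * B := by
    intro B
    have : E.conjTranspose * (E * B * E.conjTranspose) * E = B := by
      rw [Matrix.mul_assoc E, ← Matrix.mul_assoc, hE, Matrix.one_mul, Matrix.mul_assoc, hE,
        Matrix.mul_one]
    have h := h1 (E * B * E.conjTranspose)
    rwa [this] at h
  refine eq_smul_one_of_commute_of_not_commute (h2 (pauli 1)) (h2 (pauli 3)) fun h => ?_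
  have := congrFun (congrFun h 0) 1
  simp [pauli] at this
  norm_num [self_eq_neg, neg_eq_iff_add_eq_zero] at this

/-- A transversal gate acts on logical Pauli operators by an expansion whose coefficients are
products of entries of one-qubit rotations. -/
theorem exists_conj_logicalPauli {g : Matrix (Fin 2) (Fin 2) ℂ}
    {U : Fin n → Matrix.unitaryGroup (Fin 2) ℂ}
    (hU : tensorOp (fun i => (U i : Matrix (Fin 2) (Fin 2) ℂ)) * E = E * g) (p : Fin n → Fin 4) :
    ∃ x : Fin n → Fin 4 → ℝ, (∀ i, ∑ r, x i r ^ 2 = 1) ∧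
      (∀ r : Fin n → Fin 4, ∏ i, x i (r i) ≠ 0 → ∀ i, r i = 0 ↔ p i = 0) ∧
      g.conjTranspose * logicalPauli E p * g =
        ∑ r : Fin n → Fin 4, ((∏ i, x i (r i) : ℝ) : ℂ) • logicalPauli E r := by
  obtain ⟨x, h1, h2, h3⟩ := exists_unitary_conj_pauliString U p
  refine ⟨x, h1, h2, ?_⟩
  have hU' := congrArg Matrix.conjTranspose hU
  simp only [Matrix.conjTranspose_mul] at hU'
  calc g.conjTranspose * logicalPauli E p * g
      = g.conjTranspose * E.conjTranspose * pauliString p * (E * g) := by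
        simp only [logicalPauli, Matrix.mul_assoc]
    _ = E.conjTranspose * ((tensorOp fun i => (U i : Matrix (Fin 2) (Fin 2) ℂ)).conjTranspose *
          pauliString p * (tensorOp fun i => (U i : Matrix (Fin 2) (Fin 2) ℂ))) * E := by
        rw [← hU, ← hU']; simp only [Matrix.mul_assoc]
    _ = _ := by
        rw [h3, Matrix.mul_sum, Matrix.sum_mul]
        simp only [Matrix.mul_smul, Matrix.smul_mul, logicalPauli]

theorem pauliWeight_le_of_imp {p q : Fin n → Fin 4} (h : ∀ i, p i = 0 → q i = 0) :
    pauliWeight q ≤ pauliWeight p :=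
  Finset.card_le_card fun i => by simpa using fun hq hp => hq (h i hp)

theorem pauliWeight_lt_of_imp {p q : Fin n → Fin 4} (h : ∀ i, p i = 0 → q i = 0) {j : Fin n}
    (hp : p j ≠ 0) (hq : q j = 0) : pauliWeight q < pauliWeight p := by
  refine Finset.card_lt_card ⟨fun i => by simpa using fun hq hp => hq (h i hp), fun hs => ?_⟩
  have := @hs j (by simpa using hp)
  simp [hq] at this

theorem pauliMul_eq_zero_iff {a b : Fin 4} : pauliMul a b = 0 ↔ a = b := by
  revert a b; decide

theorem eq_or_eq_or_eq_pauliMul {a b c : Fin 4} (ha : a ≠ 0) (hb : b ≠ 0) (hc : c ≠ 0)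
    (hab : a ≠ b) : c = a ∨ c = b ∨ c = pauliMul a b := by
  revert a b c; decide

/-- The properties used of the encoding of a stabilizer code of distance at least two: every
Pauli operator either preserves the code or maps it to an orthogonal space, and Pauli operators of
weight less than two act as scalars. -/
structure IsPauliEncoding (E : Matrix (Fin n → Fin 2) (Fin 2) ℂ) : Prop where
  isometry : E.conjTranspose * E = 1
  dichotomy : ∀ p, logicalPauli E p = 0 ∨ pauliString p * E = E * logicalPauli E p
  scalar : ∀ p, pauliWeight p < 2 → ∃ c : ℂ, logicalPauli E p = c • 1

namespace IsPauliEncoding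

theorem preserves (hE : IsPauliEncoding E) {p : Fin n → Fin 4} (hp : logicalPauli E p ≠ 0) :
    pauliString p * E = E * logicalPauli E p :=
  (hE.dichotomy p).resolve_left hp

theorem mul_self (hE : IsPauliEncoding E) {p : Fin n → Fin 4} (hp : logicalPauli E p ≠ 0) :
    logicalPauli E p * logicalPauli E p = 1 :=
  logicalPauli_mul_self hE.isometry (hE.preserves hp)

theorem ne_zero_of_not_scalar {p : Fin n → Fin 4} (hp : ¬ ∃ c : ℂ, logicalPauli E p = c • 1) :
    logicalPauli E p ≠ 0 :=
  fun h => hp ⟨0, by rw [h, zero_smul]⟩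

/-- A non-scalar logical Pauli fails to commute with some other one, hence anticommutes with it;
conjugating by that involution flips the sign of the trace. -/
theorem trace_eq_zero (hE : IsPauliEncoding E) {p : Fin n → Fin 4}
    (hp : ¬ ∃ c : ℂ, logicalPauli E p = c • 1) : (logicalPauli E p).trace = 0 := by
  have hp0 := ne_zero_of_not_scalar hp
  have : ∃ q, logicalPauli E q * logicalPauli E p ≠ logicalPauli E p * logicalPauli E q := by
    by_contra! h
    exact hp (eq_smul_one_of_commute_logicalPauli hE.isometry h)
  obtain ⟨q, hq⟩ := this
  have hq0 : logicalPauli E q ≠ 0 := fun h => hq (by rw [h, Matrix.zero_mul, Matrix.mul_zero])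
  have hqp := (logicalPauli_comm (hE.preserves hq0) (hE.preserves hp0)).resolve_left hq
  have h1 : (logicalPauli E q * logicalPauli E p * logicalPauli E q).trace =
      (logicalPauli E p).trace := by
    rw [Matrix.trace_mul_comm, ← Matrix.mul_assoc, hE.mul_self hq0, Matrix.one_mul]
  rw [hqp, Matrix.neg_mul, Matrix.mul_assoc, hE.mul_self hq0, Matrix.mul_one,
    Matrix.trace_neg] at h1
  exact self_eq_neg.mp h1.symm

/-- If two logical Pauli operators have nonzero compressions and agree at a site of a support on
which lighter operators are scalar, then they are proportional. -/
theorem eq_smul_of_apply_eq (hE : IsPauliEncoding E) {p r : Fin n → Fin 4}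
    (hmin : ∀ q, pauliWeight q < pauliWeight p → ∃ c : ℂ, logicalPauli E q = c • 1)
    (hp : logicalPauli E p ≠ 0) (hr : ∀ i, r i = 0 ↔ p i = 0) {j : Fin n} (hj : p j ≠ 0)
    (hrj : r j = p j) : ∃ c : ℂ, logicalPauli E r = c • logicalPauli E p := by
  obtain ⟨c, -, h⟩ := exists_logicalPauli_mul (p := r) (hE.preserves hp)
  -- The product of `r` and `p` is trivial off the support and also at `j`, so it is lighter than
  -- `p`.
  obtain ⟨z, hz⟩ := hmin (fun i => pauliMul (r i) (p i)) <|
    pauliWeight_lt_of_imp (fun i hi => pauliMul_eq_zero_iff.mpr (by rw [(hr i).mpr hi, hi])) hj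
      (pauliMul_eq_zero_iff.mpr hrj)
  refine ⟨c * z, ?_⟩
  rw [hz, smul_smul] at h
  calc logicalPauli E r = logicalPauli E r * logicalPauli E p * logicalPauli E p := by
        rw [Matrix.mul_assoc, hE.mul_self hp, Matrix.mul_one]
    _ = _ := by rw [h, Matrix.smul_mul, Matrix.one_mul]

theorem exists_not_scalar (hE : IsPauliEncoding E) :
    ∃ p, ¬ ∃ c : ℂ, logicalPauli E p = c • 1 := by
  by_contra! h
  obtain ⟨c, hc⟩ := eq_smul_one_of_commute_logicalPauli hE.isometry (X := pauli 1) fun p => by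
    obtain ⟨z, hz⟩ := h p
    simp [hz]
  have := congrFun (congrFun hc 0) 1
  simp [pauli] at this

/-- If the logical gates include two non-commuting transversal gates of nonzero trace, then a
non-scalar logical Pauli operator anticommutes with another one of the same support. -/
theorem exists_anticommuting (hE : IsPauliEncoding E) {p : Fin n → Fin 4}
    (hp : ¬ ∃ c : ℂ, logicalPauli E p = c • 1) {f g : Matrix (Fin 2) (Fin 2) ℂ}
    (hf : f * f.conjTranspose = 1) (hg : g * g.conjTranspose = 1)
    (hft : f.trace ≠ 0) (hgt : g.trace ≠ 0) (hfg : f * g ≠ g * f)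
    (hfU : ∃ U : Fin n → Matrix.unitaryGroup (Fin 2) ℂ,
      tensorOp (fun i => (U i : Matrix (Fin 2) (Fin 2) ℂ)) * E = E * f)
    (hgU : ∃ U : Fin n → Matrix.unitaryGroup (Fin 2) ℂ,
      tensorOp (fun i => (U i : Matrix (Fin 2) (Fin 2) ℂ)) * E = E * g) :
    ∃ q : Fin n → Fin 4, (∀ i, q i = 0 ↔ p i = 0) ∧ logicalPauli E q ≠ 0 ∧
      logicalPauli E p * logicalPauli E q = -(logicalPauli E q * logicalPauli E p) := by
  have hp0 := ne_zero_of_not_scalar hp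
  by_contra! h
  have hcomm : ∀ q : Fin n → Fin 4, (∀ i, q i = 0 ↔ p i = 0) →
      logicalPauli E p * logicalPauli E q = logicalPauli E q * logicalPauli E p := by
    intro q hq
    by_cases hq0 : logicalPauli E q = 0
    · rw [hq0, Matrix.zero_mul, Matrix.mul_zero]
    · exact (logicalPauli_comm (hE.preserves hp0) (hE.preserves hq0)).resolve_right (h q hq hq0)
  -- If nothing on the support anticommutes with `p`, every term in the expansion of the conjugate
  -- of `p` by a gate commutes with `p`, and `commute_of_commute_conj` applies. Both `f` and `g`
  -- would then commute with `p`, making it scalar.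
  have main : ∀ g : Matrix (Fin 2) (Fin 2) ℂ, g * g.conjTranspose = 1 → g.trace ≠ 0 →
      (∃ U : Fin n → Matrix.unitaryGroup (Fin 2) ℂ,
        tensorOp (fun i => (U i : Matrix (Fin 2) (Fin 2) ℂ)) * E = E * g) →
      g * logicalPauli E p = logicalPauli E p * g := by
    rintro g hg hgt ⟨U, hU⟩
    refine commute_of_commute_conj (hE.trace_eq_zero hp) (hE.mul_self hp0) hg hgt ?_
    obtain ⟨x, -, hx, he⟩ := exists_conj_logicalPauli hU p
    rw [he, Matrix.mul_sum, Matrix.sum_mul]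
    refine Finset.sum_congr rfl fun r _ => ?_
    by_cases h0 : ∏ i, x i (r i) = 0
    · simp [h0]
    · rw [Matrix.mul_smul, Matrix.smul_mul, hcomm r (hx r h0)]
  exact hp (eq_smul_one_of_commute_of_not_commute (main f hf hft hfU) (main g hg hgt hgU) hfg)

theorem anticommute_smul_mul {A B : Matrix (Fin 2) (Fin 2) ℂ} (h : A * B = -(B * A)) (c : ℂ) :
    A * (c • (A * B)) = -(c • (A * B) * A) ∧ B * (c • (A * B)) = -(c • (A * B) * B) := by
  have h' : B * A = -(A * B) := by rw [h, neg_neg]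
  constructor
  · rw [Matrix.mul_smul, Matrix.smul_mul, ← smul_neg, Matrix.mul_assoc A B A, h', Matrix.mul_neg,
      neg_neg]
  · rw [Matrix.mul_smul, Matrix.smul_mul, ← smul_neg, ← Matrix.mul_assoc, h', Matrix.neg_mul]

/-- Some three pairwise anticommuting logical Pauli operators are the only ones with a nonzero
compression on their common support, which has at least two elements; at each site of the support
they have distinct tensor factors. -/
theorem exists_triple (hE : IsPauliEncoding E) {f g : Matrix (Fin 2) (Fin 2) ℂ}
    (hf : f * f.conjTranspose = 1) (hg : g * g.conjTranspose = 1)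
    (hft : f.trace ≠ 0) (hgt : g.trace ≠ 0) (hfg : f * g ≠ g * f)
    (hfU : ∃ U : Fin n → Matrix.unitaryGroup (Fin 2) ℂ,
      tensorOp (fun i => (U i : Matrix (Fin 2) (Fin 2) ℂ)) * E = E * f)
    (hgU : ∃ U : Fin n → Matrix.unitaryGroup (Fin 2) ℂ,
      tensorOp (fun i => (U i : Matrix (Fin 2) (Fin 2) ℂ)) * E = E * g) :
    ∃ (u : Fin 3 → Fin n → Fin 4) (i j : Fin n), i ≠ j ∧
      (Function.Injective fun b => u b i) ∧ (Function.Injective fun b => u b j) ∧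
      (∀ a, logicalPauli E (u a) ≠ 0) ∧
      (∀ a b, a ≠ b → logicalPauli E (u a) * logicalPauli E (u b) =
        -(logicalPauli E (u b) * logicalPauli E (u a))) ∧
      (∃ c : ℂ, logicalPauli E (u 2) = c • (logicalPauli E (u 0) * logicalPauli E (u 1))) ∧
      (∀ a r, (∀ i, r i = 0 ↔ u a i = 0) → logicalPauli E r ≠ 0 → r ∈ Set.range u) := by
  -- A non-scalar logical Pauli of least weight.
  obtain ⟨p, hp, hmin'⟩ := (measure (pauliWeight (n := n))).wf.has_min
    {p | ¬ ∃ c : ℂ, logicalPauli E p = c • 1} hE.exists_not_scalar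
  have hmin : ∀ q, pauliWeight q < pauliWeight p → ∃ c : ℂ, logicalPauli E q = c • 1 :=
    fun q hq => by
      by_contra h
      exact hmin' q h hq
  have hp0 := ne_zero_of_not_scalar hp
  obtain ⟨q, hqs, hq0, hpq⟩ := hE.exists_anticommuting hp hf hg hft hgt hfg hfU hgU
  set t : Fin n → Fin 4 := fun i => pauliMul (p i) (q i) with ht
  have hpp := hE.mul_self hp0
  have hqq := hE.mul_self hq0
  have hpq0 : logicalPauli E p * logicalPauli E q ≠ 0 := by
    intro h
    have : logicalPauli E p * (logicalPauli E p * logicalPauli E q) = logicalPauli E q := by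
      rw [← Matrix.mul_assoc, hpp, Matrix.one_mul]
    rw [h, Matrix.mul_zero] at this
    exact hq0 this.symm
  obtain ⟨c, hc, hct⟩ := exists_logicalPauli_mul (p := p) (hE.preserves hq0)
  have hct' : logicalPauli E t = c⁻¹ • (logicalPauli E p * logicalPauli E q) := by
    rw [hct, smul_smul, inv_mul_cancel₀ hc, one_smul]
  have ht0 : logicalPauli E t ≠ 0 := fun h => hpq0 (by rw [hct, ← ht, h, smul_zero])
  have hpt : logicalPauli E p * logicalPauli E t = -(logicalPauli E t * logicalPauli E p) := by
    rw [hct']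
    exact (anticommute_smul_mul hpq _).1
  have hqt : logicalPauli E q * logicalPauli E t = -(logicalPauli E t * logicalPauli E q) := by
    rw [hct']
    exact (anticommute_smul_mul hpq _).2
  -- A nonzero compression cannot be proportional to two anticommuting ones: it would both commute
  -- and anticommute with the second.
  have hnp : ∀ a b : Fin n → Fin 4, logicalPauli E a ≠ 0 → logicalPauli E b ≠ 0 →
      logicalPauli E a * logicalPauli E b = -(logicalPauli E b * logicalPauli E a) →
      ∀ r, logicalPauli E r ≠ 0 → (∃ z : ℂ, logicalPauli E r = z • logicalPauli E a) →
      (∃ z : ℂ, logicalPauli E r = z • logicalPauli E b) → False := by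
    rintro a b ha hb hab r hr ⟨y, hy⟩ ⟨z, hz⟩
    have hrb : logicalPauli E r * logicalPauli E b = logicalPauli E b * logicalPauli E r := by
      rw [hz, Matrix.smul_mul, Matrix.mul_smul]
    have hrb' : logicalPauli E r * logicalPauli E b =
        -(logicalPauli E b * logicalPauli E r) := by
      rw [hy, Matrix.smul_mul, Matrix.mul_smul, hab, smul_neg]
    rw [← hrb] at hrb'
    have h0 := matrix_eq_zero_of_eq_neg hrb'
    have : logicalPauli E r * logicalPauli E b * logicalPauli E b = logicalPauli E r := by
      rw [Matrix.mul_assoc, hE.mul_self hb, Matrix.mul_one]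
    rw [h0, Matrix.zero_mul] at this
    exact hr this.symm
  have hne : ∀ i, p i ≠ 0 → p i ≠ q i := fun i hi h =>
    hnp p q hp0 hq0 hpq q hq0 (hE.eq_smul_of_apply_eq hmin hp0 hqs hi h.symm) ⟨1, by simp⟩
  have hts : ∀ i, t i = 0 ↔ p i = 0 := fun i => by
    rw [ht, pauliMul_eq_zero_iff]
    exact ⟨fun h => by_contra fun h' => hne i h' h, fun h => by rw [h, (hqs i).mpr h]⟩
  have hinj : ∀ i, p i ≠ 0 →
      Function.Injective fun b => (![p, q, t] : Fin 3 → Fin n → Fin 4) b i := by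
    intro i hi
    have h1 : ∀ a b : Fin 4, a ≠ 0 → b ≠ 0 → a ≠ b →
        Function.Injective fun k => (![a, b, pauliMul a b] : Fin 3 → Fin 4) k := by decide
    have h2 : (fun b => (![p, q, t] : Fin 3 → Fin n → Fin 4) b i) =
        fun k => (![p i, q i, pauliMul (p i) (q i)] : Fin 3 → Fin 4) k := by
      ext1 k
      fin_cases k <;> rfl
    rw [h2]
    exact h1 (p i) (q i) hi (fun h => hi ((hqs i).mp h)) (hne i hi)
  obtain ⟨i, hi, j, hj, hij⟩ : ∃ i, p i ≠ 0 ∧ ∃ j, p j ≠ 0 ∧ i ≠ j := by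
    have : 1 < pauliWeight p := by
      by_contra h
      exact hp (hE.scalar p (by omega))
    obtain ⟨i, hi, j, hj, hij⟩ := Finset.one_lt_card.mp this
    exact ⟨i, by simpa using hi, j, by simpa using hj, hij⟩
  refine ⟨![p, q, t], i, j, hij, hinj i hi, hinj j hj, ?_, ?_, ⟨_, hct'⟩, ?_⟩
  · exact fun a => match a with
      | 0 => hp0
      | 1 => hq0
      | 2 => ht0
  · exact fun a b hab => match a, b, hab with
      | 0, 1, _ => hpq
      | 0, 2, _ => hpt
      | 1, 2, _ => hqt
      | 1, 0, _ => (neg_eq_iff_eq_neg.mpr hpq).symm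
      | 2, 0, _ => (neg_eq_iff_eq_neg.mpr hpt).symm
      | 2, 1, _ => (neg_eq_iff_eq_neg.mpr hqt).symm
      | 0, 0, h => absurd rfl h
      | 1, 1, h => absurd rfl h
      | 2, 2, h => absurd rfl h
  · intro a r hr hr0
    have hrs : ∀ i, r i = 0 ↔ p i = 0 := by
      intro i
      rw [hr i]
      fin_cases a
      exacts [Iff.rfl, hqs i, hts i]
    have hwq : pauliWeight q = pauliWeight p :=
      (pauliWeight_le_of_imp fun i => (hqs i).mpr).antisymm
        (pauliWeight_le_of_imp fun i => (hqs i).mp)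
    have hwt : pauliWeight t = pauliWeight p :=
      (pauliWeight_le_of_imp fun i => (hts i).mpr).antisymm
        (pauliWeight_le_of_imp fun i => (hts i).mp)
    have cp : ∀ k, p k ≠ 0 → r k = p k → ∃ z : ℂ, logicalPauli E r = z • logicalPauli E p :=
      fun k hk h => hE.eq_smul_of_apply_eq hmin hp0 hrs hk h
    have cq : ∀ k, p k ≠ 0 → r k = q k → ∃ z : ℂ, logicalPauli E r = z • logicalPauli E q :=
      fun k hk h => hE.eq_smul_of_apply_eq (by rwa [hwq]) hq0 (fun i => (hrs i).trans (hqs i).symm)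
        (fun h' => hk ((hqs k).mp h')) h
    have ct : ∀ k, p k ≠ 0 → r k = t k → ∃ z : ℂ, logicalPauli E r = z • logicalPauli E t :=
      fun k hk h => hE.eq_smul_of_apply_eq (by rwa [hwt]) ht0 (fun i => (hrs i).trans (hts i).symm)
        (fun h' => hk ((hts k).mp h')) h
    have npq := hnp p q hp0 hq0 hpq r hr0
    have npt := hnp p t hp0 ht0 hpt r hr0
    have nqt := hnp q t hq0 ht0 hqt r hr0
    -- At each site of the support `r` agrees with one of `p`, `q`, `t`. Agreement with different
    -- ones at different sites would contradict `hnp`, so `r` is one of the three.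
    have tri : ∀ k, p k ≠ 0 → r k = p k ∨ r k = q k ∨ r k = t k := fun k hk =>
      eq_or_eq_or_eq_pauliMul hk (fun h => hk ((hqs k).mp h)) (fun h => hk ((hrs k).mp h))
        (hne k hk)
    have ext0 : ∀ s : Fin n → Fin 4, (∀ i, s i = 0 ↔ p i = 0) → (∀ k, p k ≠ 0 → r k = s k) →
        r = s := by
      intro s hs h
      ext1 k
      by_cases hk : p k = 0
      · rw [(hrs k).mpr hk, (hs k).mpr hk]
      · exact h k hk
    rcases tri i hi with h | h | h
    · refine ⟨0, (ext0 p (fun _ => Iff.rfl) fun k hk => ?_).symm⟩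
      rcases tri k hk with h' | h' | h'
      exacts [h', (npq (cp i hi h) (cq k hk h')).elim, (npt (cp i hi h) (ct k hk h')).elim]
    · refine ⟨1, (ext0 q hqs fun k hk => ?_).symm⟩
      rcases tri k hk with h' | h' | h'
      exacts [(npq (cp k hk h') (cq i hi h)).elim, h', (nqt (cq i hi h) (ct k hk h')).elim]
    · refine ⟨2, (ext0 t hts fun k hk => ?_).symm⟩
      rcases tri k hk with h' | h' | h'
      exacts [(npt (cp k hk h') (ct i hi h)).elim, (nqt (cq k hk h') (ct i hi h)).elim, h']

/-- The trace of a transversal gate satisfies `|tr g|² ∈ ℤ`, as soon as two transversal gates of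
nonzero trace do not commute. -/
theorem exists_int_trace (hE : IsPauliEncoding E) {f g : Matrix (Fin 2) (Fin 2) ℂ}
    (hf : f * f.conjTranspose = 1) (hg : g * g.conjTranspose = 1)
    (hft : f.trace ≠ 0) (hgt : g.trace ≠ 0) (hfg : f * g ≠ g * f)
    (hfU : ∃ U : Fin n → Matrix.unitaryGroup (Fin 2) ℂ,
      tensorOp (fun i => (U i : Matrix (Fin 2) (Fin 2) ℂ)) * E = E * f)
    (hgU : ∃ U : Fin n → Matrix.unitaryGroup (Fin 2) ℂ,
      tensorOp (fun i => (U i : Matrix (Fin 2) (Fin 2) ℂ)) * E = E * g) :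
    ∃ z : ℤ, g.conjTranspose.trace * g.trace = z := by
  obtain ⟨u, i, j, hij, hi, hj, h0, hac, h2, hrange⟩ :=
    hE.exists_triple hf hg hft hgt hfg hfU hgU
  obtain ⟨U, hU⟩ := hgU
  have hMM := fun a => hE.mul_self (h0 a)
  have hu : Function.Injective u := fun a b hab => hi (congrFun hab i)
  have htr : ∀ a b, a ≠ b → (logicalPauli E (u a) * logicalPauli E (u b)).trace = 0 := by
    intro a b hab
    have h := congrArg Matrix.trace (hac a b hab)
    rw [Matrix.trace_neg, Matrix.trace_mul_comm (logicalPauli E (u b))] at h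
    exact self_eq_neg.mp h
  have hsum : ∀ (a : Fin 3), ∃ z : ℤ, (g.conjTranspose * logicalPauli E (u a) * g *
      logicalPauli E (u a)).trace = 2 * z := by
    intro a
    obtain ⟨x, hx1, hx2, hx3⟩ := exists_conj_logicalPauli hU (u a)
    -- The expansion only involves strings with the support of `u a`, and all of these except the `u
    -- b` compress to zero.
    have he : g.conjTranspose * logicalPauli E (u a) * g =
        ∑ b, ((∏ k, x k (u b k) : ℝ) : ℂ) • logicalPauli E (u b) := by
      rw [hx3, ← Finset.sum_image (s := Finset.univ) (g := u)
        (f := fun r => ((∏ k, x k (r k) : ℝ) : ℂ) • logicalPauli E r)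
        (fun _ _ _ _ h => hu h)]
      refine (Finset.sum_subset (Finset.subset_univ _) fun r _ hr => ?_).symm
      by_contra hne
      obtain ⟨hne1, hne2⟩ := smul_ne_zero_iff.mp hne
      obtain ⟨b, hb⟩ := hrange a r (hx2 r (by exact_mod_cast hne1)) hne2
      exact hr (Finset.mem_image.mpr ⟨b, Finset.mem_univ b, hb⟩)
    have hcoef : ∀ b, (g.conjTranspose * logicalPauli E (u a) * g *
        logicalPauli E (u b)).trace = 2 * ((∏ k, x k (u b k) : ℝ) : ℂ) := by
      intro b
      rw [he, Matrix.sum_mul, Matrix.trace_sum, Finset.sum_eq_single b]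
      · rw [Matrix.smul_mul, hMM, Matrix.trace_smul, Matrix.trace_one, smul_eq_mul, mul_comm]
        simp
      · intro b' _ hb
        rw [Matrix.smul_mul, Matrix.trace_smul, htr _ _ hb, smul_zero]
      · simp
    -- The conjugate of an involution is an involution; the trace of its square, expanded in the
    -- trace-orthogonal logical Paulis, gives the norm of the row.
    have hnorm : ∑ b, (∏ k, x k (u b k)) ^ 2 = 1 := by
      have hsq : g.conjTranspose * logicalPauli E (u a) * g *
          (g.conjTranspose * logicalPauli E (u a) * g) = 1 := by
        calc _ = g.conjTranspose * (logicalPauli E (u a) * (g * g.conjTranspose) *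
              logicalPauli E (u a)) * g := by simp only [Matrix.mul_assoc]
          _ = 1 := by
              rw [hg, Matrix.mul_one, hMM, Matrix.mul_one]
              exact mul_eq_one_comm.mp hg
      have h := congrArg Matrix.trace hsq
      nth_rewrite 2 [he] at h
      rw [Matrix.mul_sum, Matrix.trace_sum, Matrix.trace_one] at h
      simp only [Matrix.mul_smul, Matrix.trace_smul, hcoef, smul_eq_mul] at h
      have h' : ((∑ b, (∏ k, x k (u b k)) ^ 2 : ℝ) : ℂ) = 1 := by
        have : (2 : ℂ) * ((∑ b, (∏ k, x k (u b k)) ^ 2 : ℝ) : ℂ) = 2 * 1 := by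
          rw [mul_one]
          refine Eq.trans ?_ (h.trans (by simp))
          rw [Complex.ofReal_sum, Finset.mul_sum]
          exact Finset.sum_congr rfl fun b _ => by push_cast; ring
        exact mul_left_cancel₀ two_ne_zero this
      exact_mod_cast h'
    obtain ⟨z, hz⟩ := exists_int_of_sum_sq_prod_eq_one x hx1 u hij hi hj hnorm a
    exact ⟨z, by rw [hcoef, hz]; simp⟩
  choose z hz using hsum
  have := sum_trace_conj_mul (fun a => logicalPauli E (u a)) hMM hac h2
    (mul_eq_one_comm.mp hg)
  simp only [hz] at this
  -- The sum of the `z a` is the trace `|tr g|² - 1` of the rotation.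
  refine ⟨∑ a, z a + 1, ?_⟩
  rw [← Finset.mul_sum] at this
  push_cast
  linear_combination -this / 2

end IsPauliEncoding

end LogicalPauli

/-! ### From stabilizer codes to Pauli encodings, up to non-entangling gates -/

section Stabilizer

variable {n : ℕ}

/-- Matrices with range in the range of an isometry factor through it. -/
theorem eq_mul_of_forall_mem_range {ι κ l : Type*} [Fintype ι] [Fintype κ] [DecidableEq κ]
    [Fintype l] [DecidableEq l]
    {E : Matrix ι κ ℂ} {A : Matrix ι l ℂ} (hE : E.conjTranspose * E = 1)
    (h : ∀ v, A.mulVec v ∈ LinearMap.range E.mulVecLin) : A = E * (E.conjTranspose * A) := by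
  refine Matrix.ext_of_mulVec_single fun i => ?_
  obtain ⟨w, hw⟩ := h (Pi.single i 1)
  rw [Matrix.mulVecLin_apply] at hw
  rw [← Matrix.mulVec_mulVec, ← Matrix.mulVec_mulVec, ← hw, Matrix.mulVec_mulVec,
    Matrix.mulVec_mulVec, Matrix.mul_assoc, hE, Matrix.mul_one]

/-- A Pauli string commutes or anticommutes with each stabilizer. If it commutes with all of them it
preserves the code; if it anticommutes with one, inserting that stabilizer shows that the
compression equals its own negative. -/
theorem IsStabilizerCode.logicalPauli_dichotomy {C : Submodule ℂ (QubitSpace n)}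
    (hC : IsStabilizerCode C) {E : Matrix (Fin n → Fin 2) (Fin 2) ℂ} (hE : IsEncoding C E)
    (p : Fin n → Fin 4) :
    logicalPauli E p = 0 ∨ pauliString p * E = E * logicalPauli E p := by
  obtain ⟨S, hS, hSC⟩ := hC
  obtain ⟨hE1, hE2⟩ := hE
  have hmem : ∀ v, E.mulVec v ∈ C := fun v => by
    rw [← hE2]
    exact ⟨v, rfl⟩
  have hsE : ∀ s ∈ S, (s : Matrix (Fin n → Fin 2) (Fin n → Fin 2) ℂ) * E = E := fun s hs =>
    Matrix.ext_of_mulVec_single fun i => by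
      rw [← Matrix.mulVec_mulVec, (hSC _).mp (hmem _) s hs]
  have hsc : ∀ s ∈ S, (s : Matrix (Fin n → Fin 2) (Fin n → Fin 2) ℂ) * pauliString p =
        pauliString p * s ∨
      (s : Matrix (Fin n → Fin 2) (Fin n → Fin 2) ℂ) * pauliString p = -(pauliString p * s) := by
    intro s hs
    obtain ⟨k, q, hkq⟩ := hS s hs
    rw [hkq, Matrix.smul_mul, Matrix.mul_smul, ← smul_neg]
    exact (pauliString_comm q p).imp (fun h => by rw [h]) fun h => by rw [h]
  by_cases hcom : ∀ s ∈ S, (s : Matrix (Fin n → Fin 2) (Fin n → Fin 2) ℂ) * pauliString p =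
      pauliString p * s
  · right
    have := eq_mul_of_forall_mem_range (A := pauliString p * E) hE1 fun v => by
      rw [hE2, hSC]
      intro s hs
      rw [Matrix.mulVec_mulVec, ← Matrix.mul_assoc, hcom s hs, Matrix.mul_assoc, hsE s hs]
    rwa [← Matrix.mul_assoc E.conjTranspose] at this
  · left
    push Not at hcom
    obtain ⟨s, hs, hne⟩ := hcom
    have hanti := (hsc s hs).resolve_left hne
    -- The adjoint of `s⁻¹ * E = E`, as `s` is unitary.
    have hEs : E.conjTranspose * (s : Matrix (Fin n → Fin 2) (Fin n → Fin 2) ℂ) =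
        E.conjTranspose := by
      have := congrArg Matrix.conjTranspose (hsE s⁻¹ (S.inv_mem hs))
      rw [Matrix.conjTranspose_mul] at this
      simpa [Matrix.star_eq_conjTranspose] using this
    refine matrix_eq_zero_of_eq_neg ?_
    calc logicalPauli E p = E.conjTranspose *
          (s : Matrix (Fin n → Fin 2) (Fin n → Fin 2) ℂ) * pauliString p * E := by rw [hEs]; rfl
      _ = -(E.conjTranspose * pauliString p *
          ((s : Matrix (Fin n → Fin 2) (Fin n → Fin 2) ℂ) * E)) := by
        rw [Matrix.mul_assoc E.conjTranspose, hanti]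
        simp [Matrix.mul_assoc]
      _ = -logicalPauli E p := by rw [hsE s hs]; rfl

theorem IsQuantumCode.exists_logicalPauli_eq {C : Submodule ℂ (QubitSpace n)} {K d : ℕ}
    (hC : IsQuantumCode C K d) {E : Matrix (Fin n → Fin 2) (Fin 2) ℂ} (hE : IsEncoding C E)
    (p : Fin n → Fin 4) (hp : pauliWeight p < d) : ∃ c : ℂ, logicalPauli E p = c • 1 := by
  obtain ⟨c, hc⟩ := hC.detects p hp
  obtain ⟨hE1, hE2⟩ := hE
  have hmem : ∀ v, E.mulVec v ∈ C := fun v => by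
    rw [← hE2]
    exact ⟨v, rfl⟩
  have hent : ∀ (A : Matrix (Fin n → Fin 2) (Fin n → Fin 2) ℂ) (i j : Fin 2),
      (E.conjTranspose * A * E) i j =
        star (E.mulVec (Pi.single i 1)) ⬝ᵥ A.mulVec (E.mulVec (Pi.single j 1)) := by
    intro A i j
    rw [Matrix.mul_assoc, Matrix.mul_apply']
    simp only [Matrix.mulVec_single_one]
    rfl
  refine ⟨c, ?_⟩
  ext i j
  have h1 := hent 1 i j
  rw [Matrix.mul_one, hE1, Matrix.one_mulVec] at h1
  rw [logicalPauli, hent, hc _ (hmem _) _ (hmem _), ← h1, Matrix.smul_apply, smul_eq_mul]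

theorem IsNonEntangling.conjTranspose_mul_self {W : Matrix (Fin n → Fin 2) (Fin n → Fin 2) ℂ}
    (hW : IsNonEntangling W) : W.conjTranspose * W = 1 := by
  obtain ⟨U, σ, rfl⟩ := hW
  rw [Matrix.conjTranspose_mul, Matrix.mul_assoc, ← Matrix.mul_assoc (tensorOp _).conjTranspose,
    tensorOp_unitary_conjTranspose_mul_self, Matrix.one_mul, permOp_conjTranspose_mul_self]

theorem IsNonEntangling.exists_mul_tensorOp {W : Matrix (Fin n → Fin 2) (Fin n → Fin 2) ℂ}
    (hW : IsNonEntangling W) (V : Fin n → Matrix.unitaryGroup (Fin 2) ℂ) :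
    ∃ V' : Fin n → Matrix.unitaryGroup (Fin 2) ℂ,
      W * tensorOp (fun i => (V i : Matrix (Fin 2) (Fin 2) ℂ)) =
        tensorOp (fun i => (V' i : Matrix (Fin 2) (Fin 2) ℂ)) * W := by
  obtain ⟨U, σ, rfl⟩ := hW
  refine ⟨fun i => U i * V (σ i) * (U i)⁻¹, ?_⟩
  rw [Matrix.mul_assoc, permOp_mul_tensorOp, ← Matrix.mul_assoc, ← Matrix.mul_assoc,
    tensorOp_mul, tensorOp_mul]
  congr 2
  ext1 i
  exact congrArg Subtype.val (inv_mul_cancel_right (U i * V (σ i)) (U i)).symm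

/-- Conjugation by a non-entangling gate preserves the weight of Pauli operators. -/
theorem IsNonEntangling.exists_conj_pauliString {W : Matrix (Fin n → Fin 2) (Fin n → Fin 2) ℂ}
    (hW : IsNonEntangling W) (p : Fin n → Fin 4) :
    ∃ x : (Fin n → Fin 4) → ℂ, (∀ r, x r ≠ 0 → pauliWeight r = pauliWeight p) ∧
      W.conjTranspose * pauliString p * W = ∑ r, x r • pauliString r := by
  obtain ⟨U, σ, rfl⟩ := hW
  obtain ⟨x, -, hx, h⟩ := exists_unitary_conj_pauliString U p
  refine ⟨fun r => ((∏ i, x i ((r ∘ σ) i) : ℝ) : ℂ), fun r hr => ?_, ?_⟩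
  · have h1 := hx (r ∘ σ) (Complex.ofReal_ne_zero.mp hr)
    rw [← pauliWeight_comp_perm σ r]
    exact (pauliWeight_le_of_imp fun i => (h1 i).mpr).antisymm
      (pauliWeight_le_of_imp fun i => (h1 i).mp)
  · have : (tensorOp (fun i => (U i : Matrix (Fin 2) (Fin 2) ℂ)) * permOp σ).conjTranspose *
        pauliString p * (tensorOp (fun i => (U i : Matrix (Fin 2) (Fin 2) ℂ)) * permOp σ) =
        (permOp σ).conjTranspose * ((tensorOp fun i =>
          (U i : Matrix (Fin 2) (Fin 2) ℂ)).conjTranspose * pauliString p *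
          (tensorOp fun i => (U i : Matrix (Fin 2) (Fin 2) ℂ))) * permOp σ := by
      rw [Matrix.conjTranspose_mul]
      simp only [Matrix.mul_assoc]
    rw [this, h, Matrix.mul_sum, Matrix.sum_mul]
    simp only [Matrix.mul_smul, Matrix.smul_mul, permOp_conj_pauliString]
    refine Fintype.sum_equiv (Equiv.arrowCongr σ (Equiv.refl _)) _ _ fun r => ?_
    have hr : (Equiv.arrowCongr σ (Equiv.refl (Fin 4)) r : Fin n → Fin 4) = r ∘ σ.symm := rfl
    rw [hr, Function.comp_assoc, Equiv.symm_comp_self, Function.comp_id]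

/-- The dichotomy comes from the stabilizer code `C'`, scalarity from the distance of `C`:
conjugation by `W` turns a string of weight below two into a combination of strings of the same
weight. -/
theorem isPauliEncoding_of_codeEquivalent {C C' : Submodule ℂ (QubitSpace n)} {K d : ℕ}
    (hd : 2 ≤ d) (hC : IsQuantumCode C K d) (hC' : IsStabilizerCode C')
    {W : Matrix (Fin n → Fin 2) (Fin n → Fin 2) ℂ} (hW : IsNonEntangling W)
    (hCC' : C.map (Matrix.mulVecLin W) = C') {E : Matrix (Fin n → Fin 2) (Fin 2) ℂ}
    (hE : IsEncoding C E) : IsPauliEncoding (W * E) := by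
  have hiso : (W * E).conjTranspose * (W * E) = 1 := by
    rw [Matrix.conjTranspose_mul, Matrix.mul_assoc, ← Matrix.mul_assoc W.conjTranspose,
      hW.conjTranspose_mul_self, Matrix.one_mul, hE.1]
  refine ⟨hiso, hC'.logicalPauli_dichotomy ⟨hiso, ?_⟩, fun p hp => ?_⟩
  · rw [Matrix.mulVecLin_mul, LinearMap.range_comp, hE.2, hCC']
  · obtain ⟨x, hx, h⟩ := hW.exists_conj_pauliString p
    have hc : ∀ r, ∃ c : ℂ, x r • logicalPauli E r = c • 1 := by
      intro r
      by_cases hr : x r = 0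
      · exact ⟨0, by simp [hr]⟩
      · obtain ⟨c, hc⟩ := hC.exists_logicalPauli_eq hE r (by rw [hx r hr]; omega)
        exact ⟨x r * c, by rw [hc, smul_smul]⟩
    choose c hc using hc
    refine ⟨∑ r, c r, ?_⟩
    calc logicalPauli (W * E) p = E.conjTranspose * (W.conjTranspose * pauliString p * W) * E := by
          simp only [logicalPauli, Matrix.conjTranspose_mul, Matrix.mul_assoc]
      _ = ∑ r, x r • logicalPauli E r := by
          rw [h, Matrix.mul_sum, Matrix.sum_mul]
          simp only [Matrix.mul_smul, Matrix.smul_mul, logicalPauli]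
      _ = _ := by simp only [hc, Finset.sum_smul]

end Stabilizer

/-! ### The main theorem -/

theorem mainTheorem3 (n d : ℕ) (hd : 2 ≤ d) (C : Submodule ℂ (QubitSpace n))
    (hC : IsQuantumCode C 2 d)
    (G : Subgroup (Matrix.specialUnitaryGroup (Fin 2) ℂ)) (hG : IsBinaryIcosahedral G)
    (hCG : ImplementsTransversally C G) :
    IsNonAdditive C := by
  rintro ⟨C', hC', W, hW, hCC'⟩
  obtain ⟨h, rfl⟩ := hG
  obtain ⟨E, hE, hEG⟩ := hCG
  have hWE := isPauliEncoding_of_codeEquivalent hd hC hC' hW hCC' hE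
  have hU : ∀ g ∈ binaryIcosahedral, ∃ U : Fin n → Matrix.unitaryGroup (Fin 2) ℂ,
      tensorOp (fun i => (U i : Matrix (Fin 2) (Fin 2) ℂ)) * (W * E) =
        W * E * ((h * g * h⁻¹ : Matrix.specialUnitaryGroup (Fin 2) ℂ) :
          Matrix (Fin 2) (Fin 2) ℂ) := by
    intro g hg
    obtain ⟨V, hV⟩ := hEG (h * g * h⁻¹) ⟨g, hg, rfl⟩
    obtain ⟨V', hV'⟩ := hW.exists_mul_tensorOp V
    exact ⟨V', by rw [← Matrix.mul_assoc, ← hV', Matrix.mul_assoc, hV, ← Matrix.mul_assoc]⟩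
  have hunit : ∀ g : Matrix.specialUnitaryGroup (Fin 2) ℂ,
      (g : Matrix (Fin 2) (Fin 2) ℂ) * (g : Matrix (Fin 2) (Fin 2) ℂ).conjTranspose = 1 :=
    fun g => g.2.1.2
  have htr : ∀ g : Matrix.specialUnitaryGroup (Fin 2) ℂ,
      ((h * g * h⁻¹ : Matrix.specialUnitaryGroup (Fin 2) ℂ) : Matrix (Fin 2) (Fin 2) ℂ).trace =
        (g : Matrix (Fin 2) (Fin 2) ℂ).trace := by
    intro g
    have h1 : ((h⁻¹ * (h * g) : Matrix.specialUnitaryGroup (Fin 2) ℂ) :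
      Matrix (Fin 2) (Fin 2) ℂ) = g := by rw [inv_mul_cancel_left]
    rw [← h1]
    exact Matrix.trace_mul_comm _ _
  have hF : gateF ∈ binaryIcosahedral := Subgroup.subset_closure (by simp)
  have hPhi : gatePhi ∈ binaryIcosahedral := Subgroup.subset_closure (by simp)
  have hnc : ((h * gateF * h⁻¹ : Matrix.specialUnitaryGroup (Fin 2) ℂ) :
        Matrix (Fin 2) (Fin 2) ℂ) * (h * gatePhi * h⁻¹ : Matrix.specialUnitaryGroup (Fin 2) ℂ) ≠
      (h * gatePhi * h⁻¹ : Matrix.specialUnitaryGroup (Fin 2) ℂ) *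
        (h * gateF * h⁻¹ : Matrix.specialUnitaryGroup (Fin 2) ℂ) := by
    intro hc
    have hc' : h * gateF * h⁻¹ * (h * gatePhi * h⁻¹) = h * gatePhi * h⁻¹ * (h * gateF * h⁻¹) :=
      Subtype.ext hc
    simp only [mul_assoc, inv_mul_cancel_left, mul_right_inj] at hc'
    have : gateF * gatePhi = gatePhi * gateF :=
      mul_right_cancel (b := h⁻¹) (by rw [mul_assoc, mul_assoc, hc'])
    exact gateF_gatePhi_not_commute (congrArg Subtype.val this)
  -- `F` and `Φ` are the two non-commuting gates, with traces `1` and `φ`, unchanged by the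
  -- conjugation by `h`.
  obtain ⟨z, hz⟩ := hWE.exists_int_trace (hunit _) (hunit _)
    (by rw [htr, gateF_trace]; exact one_ne_zero)
    (by rw [htr, gatePhi_trace]; exact_mod_cast Real.goldenRatio_ne_zero)
    hnc (hU _ hF) (hU _ hPhi)
  rw [Matrix.trace_conjTranspose, htr, gatePhi_trace] at hz
  have hz' : Real.goldenRatio * Real.goldenRatio = z := by
    have : star (Real.goldenRatio : ℂ) = Real.goldenRatio := Complex.conj_ofReal _
    rw [this] at hz
    exact_mod_cast hz
  -- From `φ² = φ + 1` and `φ² = z`.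
  refine Real.goldenRatio_irrational ⟨z - 1, ?_⟩
  have := Real.goldenRatio_sq
  push_cast
  linarith
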